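/- Let $p\ge 2$ be a real number and let $E$ be a (real) $\sigma$-Dedekind complete Banach lattice, i.e. a Banach lattice in which every nonempty countable subset that is bounded above has a supremum. Then $E$ has the positive $DP^*$ property of order $p$ if and only if $E$ has the disjoint $DP^*P_p$. Here: - A sequence $(x_n)_n$ in $E$ is weakly $p$-summable if $\sum_n |x^*(x_n)|^p<\infty$ for every $x^*\in E^*$, and disjoint if $|x_m|\wedge|x_n|=0$ whenever $m\ne n$. - A set $K\subseteq E$ is weakly $p$-compact if every sequence in $K$ has a subsequence $(y_n)_n$ for which there is $a\in K$ such that $(y_n-a)_n$ is weakly $p$-summable. - A set $A\subseteq E$ is limited if $\sup_{x\in A}|x_n^*(x)|\to 0$ for every weak* null sequence $(x_n^*)_n$ in $E^*$. A bounded set $A\subseteq E$ is positively limited if $\sup_{x\in A}|x_n^*(x)|\to 0$ for every weak* null sequence $(x_n^*)_n$ of positive functionals in $E^*$. - $E$ has the positive $DP^*$ property of order $p$ if every weakly $p$-compact subset of $E$ is positively limited. - $E$ has the disjoint $DP^*P_p$ (disjoint Dunford-Pettis* property of order $p$) if, for every disjoint weakly $p$-summable sequence $(x_n)_n$ in $E$,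 the set $\{x_n:n\in\mathbb N\}$ is limited. -/

import Mathlib

open Filter Topology

namespace BanachLattice

/-- `σ`-Dedekind completeness: every nonempty countable subset that is bounded above has a
supremum. -/
def IsSigmaDedekindComplete (E : Type*) [Lattice E] : Prop :=
  ∀ s : Set E, s.Nonempty → s.Countable → BddAbove s → ∃ a : E, IsLUB s a

/-- A sequence in a vector lattice is disjoint if its terms are pairwise disjoint:
`|x m| ⊓ |x n| = 0` for `m ≠ n`. -/
def IsDisjointSeq {E : Type*} [AddCommGroup E] [Lattice E] (x : ℕ → E) : Prop :=
  ∀ m n : ℕ, m ≠ n → |x m| ⊓ |x n| = 0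

/-- A sequence is weakly `p`-summable if `∑ |φ (x n)| ^ p < ∞` for every continuous linear
functional `φ`. -/
def IsWeaklyPSummable {X : Type*} [NormedAddCommGroup X] [NormedSpace ℝ X]
    (p : ℝ) (x : ℕ → X) : Prop :=
  ∀ φ : StrongDual ℝ X, Summable fun n => |φ (x n)| ^ p

/-- A set `K` is weakly `p`-compact if every sequence in `K` has a subsequence that is weakly
`p`-convergent to some `a ∈ K`, i.e. whose difference with `a` is weakly `p`-summable. -/
def IsWeaklyPCompact {X : Type*} [NormedAddCommGroup X] [NormedSpace ℝ X]
    (p : ℝ) (K : Set X) : Prop :=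
  ∀ x : ℕ → X, (∀ n, x n ∈ K) →
    ∃ a ∈ K, ∃ θ : ℕ → ℕ, StrictMono θ ∧ IsWeaklyPSummable p fun n => x (θ n) - a

/-- A sequence in the dual that converges to zero in the weak* topology. -/
def IsWeakStarNull {X : Type*} [NormedAddCommGroup X] [NormedSpace ℝ X]
    (f : ℕ → StrongDual ℝ X) : Prop :=
  Tendsto (fun n => StrongDual.toWeakDual (f n)) atTop (𝓝 0)

/-- A set is limited if every weak* null sequence in the dual converges to zero uniformly
on it. -/
def IsLimited {X : Type*} [NormedAddCommGroup X] [NormedSpace ℝ X] (A : Set X) : Prop :=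
  ∀ f : ℕ → StrongDual ℝ X, IsWeakStarNull f →
    TendstoUniformlyOn (fun n x => f n x) (fun _ => 0) atTop A

/-- A bounded set is positively limited if every weak* null sequence of positive functionals
converges to zero uniformly on it. -/
def IsPositivelyLimited {E : Type*} [NormedAddCommGroup E] [NormedSpace ℝ E] [Lattice E]
    (A : Set E) : Prop :=
  Bornology.IsBounded A ∧
    ∀ f : ℕ → StrongDual ℝ E, (∀ n, ∀ x : E, 0 ≤ x → 0 ≤ f n x) → IsWeakStarNull f →
      TendstoUniformlyOn (fun n x => f n x) (fun _ => 0) atTop A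

/-- The disjoint Dunford-Pettis* property of order `p`: every disjoint weakly `p`-summable
sequence is limited (i.e. its set of terms is). -/
def HasDisjointDPStar (p : ℝ) (E : Type*) [NormedAddCommGroup E] [NormedSpace ℝ E]
    [Lattice E] : Prop :=
  ∀ x : ℕ → E, IsDisjointSeq x → IsWeaklyPSummable p x → IsLimited (Set.range x)

/-- The positive Dunford-Pettis* property of order `p`: every weakly `p`-compact set is
positively limited. -/
def HasPositiveDPStar (p : ℝ) (E : Type*) [NormedAddCommGroup E] [NormedSpace ℝ E]
    [Lattice E] : Prop :=
  ∀ K : Set E, IsWeaklyPCompact p K → IsPositivelyLimited K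

end BanachLattice

set_option linter.unusedSectionVars false

namespace BanachLattice

/-! ### Disjointness and decomposition in lattice-ordered groups. -/

section Order

/-! Both directions use the modulus of a functional taken over a principal ideal
(`restrictedModulus`).

Positive to disjoint: for weak* null fₙ and disjoint xₙ, Hahn–Banach yields positive gₙ lying below
the modulus of fₙ over the ideal of xₙ, with equality at |xₙ|. For z ≥ 0, gₙ(z) exceeds some fₙ(wₙ)
by at most 1/(n+1), where the wₙ are disjoint and |wₙ| ≤ z. A Rosenthal argument, with suprema
supplied by σ-Dedekind completeness, gives fₙ(wₙ) → 0. So gₙ is weak* null and tends to 0 uniformly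
on the weakly p-compact set {0} ∪ {|xₙ|}.

Disjoint to positive: if positive weak* null fₙ are not uniformly small on a weakly p-compact set,
subtracting a limit gives weakly p-summable xₙ with |fₙ(xₙ)| bounded below. Along a sparse
subsequence |xₙ| shrinks to a disjoint sequence on which fₙ is still bounded below, a contradiction.

Both need `IsWeaklyPSummable.of_disjoint_of_abs_le`: functionals carried by disjoint ideals combine,
with suitable signs, into one functional of norm at most ‖φ‖. -/

theorem inf_eq_zero_mono {G : Type*} [AddCommGroup G] [Lattice G] {a b c d : G} (ha : 0 ≤ a) (hb : 0 ≤ b) (hac : a ≤ c) (hbd : b ≤ d)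
    (h : c ⊓ d = 0) : a ⊓ b = 0 :=
  le_antisymm ((inf_le_inf hac hbd).trans h.le) (le_inf ha hb)

variable {G : Type*} [AddCommGroup G] [Lattice G] [IsOrderedAddMonoid G]

theorem add_le_of_inf_eq_zero {a b c : G} (h : a ⊓ b = 0) (ha : a ≤ c) (hb : b ≤ c) :
    a + b ≤ c := by
  rw [← inf_add_sup, h, zero_add]
  exact sup_le ha hb

theorem inf_add_eq_zero {a b c : G} (ha : 0 ≤ a) (hb : 0 ≤ b) (hc : 0 ≤ c)
    (hab : a ⊓ b = 0) (hac : a ⊓ c = 0) : a ⊓ (b + c) = 0 := by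
  refine le_antisymm ?_ (le_inf ha (add_nonneg hb hc))
  have h1 : a ⊓ (b + c) - c ≤ a ⊓ b :=
    le_inf ((sub_le_self _ hc).trans inf_le_left) (sub_le_iff_le_add.2 inf_le_right)
  rw [hab, sub_nonpos] at h1
  exact (le_inf inf_le_left h1).trans hac.le

theorem inf_sum_eq_zero {ι : Type*} (s : Finset ι) {a : G} {w : ι → G} (ha : 0 ≤ a)
    (hw : ∀ i, 0 ≤ w i) (h : ∀ i ∈ s, a ⊓ w i = 0) : a ⊓ ∑ i ∈ s, w i = 0 := by
  classical
  induction s using Finset.induction_on with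
  | empty => simpa using ha
  | insert i s hi ih =>
    rw [Finset.sum_insert hi]
    exact inf_add_eq_zero ha (hw i) (Finset.sum_nonneg fun j _ => hw j)
      (h i (Finset.mem_insert_self i s)) (ih fun j hj => h j (Finset.mem_insert_of_mem hj))

/-- The sum of finitely many pairwise disjoint elements is dominated by any common bound. -/
theorem sum_le_of_disjoint {ι : Type*} (s : Finset ι) {w : ι → G} {z : G} (hz : 0 ≤ z)
    (hw : ∀ i, 0 ≤ w i) (hwz : ∀ i, w i ≤ z) (hd : ∀ i j, i ≠ j → w i ⊓ w j = 0) :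
    ∑ i ∈ s, w i ≤ z := by
  classical
  induction s using Finset.induction_on with
  | empty => simpa using hz
  | insert i s hi ih =>
    rw [Finset.sum_insert hi]
    exact add_le_of_inf_eq_zero (inf_sum_eq_zero s (hw i) hw fun j hj =>
      hd i j fun hij => hi (hij ▸ hj)) (hwz i) ih

theorem abs_sum_le {ι : Type*} (s : Finset ι) (w : ι → G) : |∑ i ∈ s, w i| ≤ ∑ i ∈ s, |w i| := by
  classical
  induction s using Finset.induction_on with
  | empty => simp
  | insert i s hi ih =>
    rw [Finset.sum_insert hi, Finset.sum_insert hi]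
    exact (abs_add_le _ _).trans (add_le_add_right ih _)

/-- The Riesz decomposition property. -/
theorem exists_riesz_decomposition {w a b : G} (ha : 0 ≤ a) (hb : 0 ≤ b) (h : |w| ≤ a + b) :
    ∃ u v, w = u + v ∧ |u| ≤ a ∧ |v| ≤ b ∧ |u| ≤ |w| := by
  obtain ⟨h1, h2⟩ := abs_le'.1 h
  have h3 : -a - b ≤ w := by
    rw [← neg_add', neg_le]; exact h2
  -- Truncate `w` to the interval [-a, a]; the remainder stays within `b`.
  refine ⟨(w ⊓ a) ⊔ -a, w - ((w ⊓ a) ⊔ -a), by abel, ?_, ?_, ?_⟩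
  · exact abs_le'.2 ⟨sup_le inf_le_right ((neg_nonpos.2 ha).trans ha), neg_le.1 le_sup_right⟩
  · refine abs_le'.2 ⟨?_, ?_⟩
    · rw [sub_le_comm]
      exact (le_inf (sub_le_self _ hb) (sub_le_iff_le_add.2 h1)).trans le_sup_left
    · rw [neg_sub, sub_le_iff_le_add]
      refine sup_le (inf_le_left.trans (le_add_of_nonneg_left hb)) ?_
      rw [add_comm]
      exact sub_le_iff_le_add.1 h3
  · refine abs_le'.2 ⟨sup_le (inf_le_left.trans (le_abs_self w))
      ((neg_nonpos.2 ha).trans (abs_nonneg w)), neg_le.1 ?_⟩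
    exact (le_inf (neg_le.1 (neg_le_abs w)) ((neg_nonpos.2 (abs_nonneg w)).trans ha)).trans le_sup_left

theorem posPart_add_le (x y : G) : (x + y)⁺ ≤ x⁺ + y⁺ :=
  sup_le (add_le_add (le_posPart x) (le_posPart y))
    (add_nonneg (posPart_nonneg x) (posPart_nonneg y))

/-- In a `σ`-Dedekind complete lattice group, the partial suprema of an order bounded disjoint
sequence form a finitely additive set function. -/
theorem exists_additive_sup_of_isSigmaDedekindComplete
    (hE : IsSigmaDedekindComplete G) {y : ℕ → G} {x : G}
    (hx : 0 ≤ x) (hy : ∀ n, 0 ≤ y n) (hyx : ∀ n, y n ≤ x) (hd : IsDisjointSeq y) :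
    ∃ s : Set ℕ → G, (∀ A, 0 ≤ s A ∧ s A ≤ x) ∧ (∀ n, s {n} = y n) ∧
      ∀ A B, Disjoint A B → s (A ∪ B) = s A + s B := by
  -- Inserting 0 covers `A = ∅` and makes every `s A` nonnegative.
  have hex : ∀ A : Set ℕ, ∃ a, IsLUB (insert 0 (y '' A)) a := fun A =>
    hE _ (Set.insert_nonempty _ _) ((A.to_countable.image y).insert 0)
      ⟨x, by rintro _ (rfl | ⟨n, -, rfl⟩); exacts [hx, hyx n]⟩
  choose s hs using hex
  have h0 : ∀ A, 0 ≤ s A := fun A => (hs A).1 (Set.mem_insert _ _)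
  have hmem : ∀ A n, n ∈ A → y n ≤ s A := fun A n hn =>
    (hs A).1 (Set.mem_insert_of_mem _ ⟨n, hn, rfl⟩)
  have hle : ∀ A z, 0 ≤ z → (∀ n ∈ A, y n ≤ z) → s A ≤ z := fun A z hz h =>
    (hs A).2 (by rintro _ (rfl | ⟨n, hn, rfl⟩); exacts [hz, h n hn])
  have hmono : ∀ A B, A ⊆ B → s A ≤ s B := fun A B hAB =>
    hle A _ (h0 B) fun n hn => hmem B n (hAB hn)
  refine ⟨s, fun A => ⟨h0 A, hle A x hx fun n _ => hyx n⟩, fun n => ?_, fun A B hAB => ?_⟩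
  · exact le_antisymm (hle _ _ (hy n) (by rintro m rfl; exact le_rfl)) (hmem _ n rfl)
  · refine le_antisymm (hle _ _ (add_nonneg (h0 A) (h0 B)) ?_) ?_
    · rintro n (hn | hn)
      · exact (hmem A n hn).trans (le_add_of_nonneg_right (h0 B))
      · exact (hmem B n hn).trans (le_add_of_nonneg_left (h0 A))
    · have hA := hmono A (A ∪ B) Set.subset_union_left
      have hB := hmono B (A ∪ B) Set.subset_union_right
      rw [← le_sub_iff_add_le']
      refine hle B _ (sub_nonneg.2 hA) fun l hl => ?_
      rw [le_sub_comm]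
      refine hle A _ (sub_nonneg.2 (hmem _ l (Or.inr hl))) fun k hk => ?_
      rw [le_sub_iff_add_le]
      refine add_le_of_inf_eq_zero ?_ (hmem _ k (Or.inl hk)) (hmem _ l (Or.inr hl))
      have := hd k l fun h => hAB.le_bot ⟨hk, h ▸ hl⟩
      rwa [abs_of_nonneg (hy k), abs_of_nonneg (hy l)] at this

end Order

/-! ### Rosenthal's disjointness lemma. -/

section Rosenthal

/-- A form of Rosenthal's lemma: uniformly bounded superadditive set functions `ν n` are
simultaneously small off the diagonal on some infinite set. -/
theorem exists_infinite_subset_of_superadditive {ν : ℕ → Set ℕ → ℝ} {δ : ℝ} (hδ : 0 ≤ δ)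
    (h0 : ∀ n A, 0 ≤ ν n A)
    (hadd : ∀ n A B, Disjoint A B → ν n A + ν n B ≤ ν n (A ∪ B)) (j : ℕ) (N : Set ℕ)
    (hN : N.Infinite) (hν : ∀ n ∈ N, ν n N ≤ j * δ) :
    ∃ M ⊆ N, M.Infinite ∧ ∀ n ∈ M, ν n (M \ {n}) ≤ δ := by
  have hmono : ∀ n A B, A ⊆ B → ν n A ≤ ν n B := fun n A B hAB => by
    have := hadd n A (B \ A) Set.disjoint_sdiff_right
    rw [Set.union_sdiff_cancel hAB] at this
    linarith [h0 n (B \ A)]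
  induction j generalizing N with
  | zero =>
    refine ⟨N, subset_rfl, hN, fun n hn => ?_⟩
    have := hν n hn
    simp only [Nat.cast_zero, zero_mul] at this
    exact (hmono n _ _ Set.sdiff_subset).trans (this.trans hδ)
  | succ j ih =>
    -- Split `N` into disjoint infinite pieces `M i`. If every piece fails at some `n i`, the set of
    -- all `n i` misses `M i \ {n i}`, so superadditivity removes one δ from its mass and the
    -- induction continues there.
    let e := hN.natEmbedding
    let M : ℕ → Set ℕ := fun i => Set.range fun k => (e (Nat.pair i k) : ℕ)
    have hMN : ∀ i, M i ⊆ N := by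
      rintro i _ ⟨k, rfl⟩; exact (e _).2
    have hinj : ∀ i i' k k', (e (Nat.pair i k) : ℕ) = e (Nat.pair i' k') → i = i' ∧ k = k' :=
      fun i i' k k' h => Nat.pair_eq_pair.1 (e.injective (Subtype.ext h))
    by_cases h : ∃ i, ∀ n ∈ M i, ν n (M i \ {n}) ≤ δ
    · obtain ⟨i, hi⟩ := h
      exact ⟨M i, hMN i, Set.infinite_range_of_injective fun k k' h => (hinj _ _ _ _ h).2, hi⟩
    · push Not at h
      choose n hnM hn using h
      choose k hk using hnM
      have hn_inj : Function.Injective n := fun i i' hi => by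
        rw [← hk i, ← hk i'] at hi
        exact (hinj _ _ _ _ hi).1
      have hsub : Set.range n ⊆ N := by
        rintro _ ⟨i, rfl⟩; exact hMN i ⟨k i, hk i⟩
      obtain ⟨M', h1, h2, h3⟩ := ih (Set.range n) (Set.infinite_range_of_injective hn_inj) <| by
        rintro _ ⟨i, rfl⟩
        have hdisj : Disjoint (Set.range n) (M i \ {n i}) := by
          rw [Set.disjoint_left]
          rintro _ ⟨i', rfl⟩ ⟨⟨l, hl⟩, hne⟩
          apply hne
          have : i' = i := by
            rw [← hk i'] at hl
            exact (hinj _ _ _ _ hl).1.symm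
          rw [this]; rfl
        have h4 := hadd (n i) _ _ hdisj
        have h5 := hmono (n i) _ N (Set.union_subset hsub ((Set.sdiff_subset (t := {n i})).trans (hMN i)))
        have h6 := hν (n i) (hsub ⟨i, rfl⟩)
        push_cast at h6
        linarith [hn i]
      exact ⟨M', h1.trans hsub, h2, h3⟩

end Rosenthal

/-! ### Signs by averaging. -/

section Signs

theorem two_mul_abs_rpow_le {p : ℝ} (hp : 1 ≤ p) (a b : ℝ) :
    2 * |a| ^ p ≤ |a + b| ^ p + |a - b| ^ p := by
  have h := (convexOn_rpow hp).2 (abs_nonneg (a + b)) (abs_nonneg (a - b))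
    (by norm_num : (0 : ℝ) ≤ 1 / 2) (by norm_num : (0 : ℝ) ≤ 1 / 2) (by norm_num)
  simp only [smul_eq_mul] at h
  have h2 : |a| ≤ 1 / 2 * |a + b| + 1 / 2 * |a - b| := by
    have := abs_add_le (a + b) (a - b)
    rw [show a + b + (a - b) = 2 * a by ring, abs_mul, abs_two] at this
    linarith
  have h3 := Real.rpow_le_rpow (abs_nonneg a) h2 (by linarith : 0 ≤ p)
  linarith

/-- Some choice of signs makes the row sums of a square matrix at least as large, in `ℓᵖ`-norm,
as its diagonal. -/
theorem exists_signs {p : ℝ} (hp : 1 ≤ p) (a : ℕ → ℕ → ℝ) (N : ℕ) :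
    ∃ ε : ℕ → ℝ, (∀ n, |ε n| = 1) ∧
      ∑ m ∈ Finset.range N, |a m m| ^ p ≤
        ∑ m ∈ Finset.range N, |∑ n ∈ Finset.range N, ε n * a m n| ^ p := by
  induction N with
  | zero => exact ⟨fun _ => 1, by simp, by simp⟩
  | succ N ih =>
    obtain ⟨ε, hε, h⟩ := ih
    let S : ℝ → ℝ := fun t =>
      ∑ m ∈ Finset.range (N + 1), |∑ n ∈ Finset.range N, ε n * a m n + t * a m N| ^ p
    -- Average over the sign of the new column: rows m < N keep at least their old contribution, and
    -- in row N the averaging isolates the diagonal entry.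
    have key : 2 * ∑ m ∈ Finset.range (N + 1), |a m m| ^ p ≤ S 1 + S (-1) := by
      simp only [S]
      rw [← Finset.sum_add_distrib, Finset.sum_range_succ, Finset.sum_range_succ, mul_add]
      refine add_le_add ?_ ?_
      · refine (mul_le_mul_of_nonneg_left h zero_le_two).trans ?_
        rw [Finset.mul_sum]
        refine Finset.sum_le_sum fun m _ => ?_
        have := two_mul_abs_rpow_le hp (∑ n ∈ Finset.range N, ε n * a m n) (a m N)
        simpa [sub_eq_add_neg] using this
      · have := two_mul_abs_rpow_le hp (a N N) (∑ n ∈ Finset.range N, ε n * a N n)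
        rw [abs_sub_comm, add_comm (a N N)] at this
        simpa [sub_eq_add_neg] using this
    have hext : ∀ t, |t| = 1 → ∑ m ∈ Finset.range (N + 1), |a m m| ^ p ≤ S t →
        ∃ ε : ℕ → ℝ, (∀ n, |ε n| = 1) ∧ ∑ m ∈ Finset.range (N + 1), |a m m| ^ p ≤
          ∑ m ∈ Finset.range (N + 1), |∑ n ∈ Finset.range (N + 1), ε n * a m n| ^ p := by
      intro t ht hS
      refine ⟨Function.update ε N t, fun n => ?_, hS.trans (le_of_eq ?_)⟩
      · by_cases hn : n = N
        · subst hn; simpa using ht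
        · simpa [Function.update_of_ne hn] using hε n
      · refine Finset.sum_congr rfl fun m _ => ?_
        rw [Finset.sum_range_succ _ N, Function.update_self]
        congr 3
        refine Finset.sum_congr rfl fun n hn => ?_
        rw [Function.update_of_ne (Finset.mem_range.1 hn).ne]
    by_cases h1 : ∑ m ∈ Finset.range (N + 1), |a m m| ^ p ≤ S 1
    · exact hext 1 (by simp) h1
    · exact hext (-1) (by simp) (by linarith)

end Signs

/-! ### Hahn–Banach for sublinear majorants. -/

section HahnBanach

/-- A functional dominated by a continuous sublinear function and agreeing with it at a point. -/
theorem exists_le_sublinear_apply_eq {X : Type*} [NormedAddCommGroup X] [NormedSpace ℝ X]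
    {N : X → ℝ} (hom : ∀ c : ℝ, 0 < c → ∀ x, N (c • x) = c * N x)
    (hadd : ∀ x y, N (x + y) ≤ N x + N y) {C : ℝ} (hC : ∀ x, N x ≤ C * ‖x‖) (x₀ : X) :
    ∃ g : StrongDual ℝ X, g x₀ = N x₀ ∧ ∀ x, g x ≤ N x := by
  have h0 : N 0 = 0 := by
    have := hom 2 two_pos 0
    rw [smul_zero] at this
    linarith
  have hH : ∀ c : ℝ, c • x₀ = 0 → c • N x₀ = 0 := by
    intro c hc
    rcases smul_eq_zero.1 hc with rfl | h
    · simp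
    · simp [h, h0]
  obtain ⟨g, hg, hgN⟩ := exists_extension_of_le_sublinear
    (LinearPMap.mkSpanSingleton' x₀ (N x₀) hH) N hom hadd (by
      rintro ⟨x, hx⟩
      obtain ⟨c, rfl⟩ := Submodule.mem_span_singleton.1 hx
      rw [LinearPMap.mkSpanSingleton'_apply, smul_eq_mul]
      rcases lt_trichotomy c 0 with hc | rfl | hc
      · have h1 := hadd (c • x₀) ((-c) • x₀)
        rw [← add_smul, add_neg_cancel, zero_smul, h0, hom _ (neg_pos.2 hc)] at h1
        simp only [RingHom.id_apply]
        linarith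
      · simp [h0]
      · exact (hom c hc x₀).ge)
  refine ⟨g.mkContinuous C fun x => ?_, ?_, hgN⟩
  · rw [Real.norm_eq_abs]
    refine abs_le'.2 ⟨(hgN x).trans (hC x), ?_⟩
    rw [← map_neg, ← norm_neg]
    exact (hgN _).trans (hC _)
  · have h1 := hg ⟨x₀, Submodule.mem_span_singleton_self x₀⟩
    exact h1.trans (LinearPMap.mkSpanSingleton'_apply_self _ _ _ _)

end HahnBanach

/-! ### Scalars, principal ideals and disjointification. -/

section Smul

variable {V : Type*} [AddCommGroup V] [Lattice V] [IsOrderedAddMonoid V] [Module ℝ V]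
  [IsOrderedModule ℝ V]

theorem abs_smul_le {c : ℝ} (hc : 0 ≤ c) (w : V) : |c • w| ≤ c • |w| :=
  abs_le'.2 ⟨smul_le_smul_of_nonneg_left (le_abs_self w) hc, by
    rw [← smul_neg]; exact smul_le_smul_of_nonneg_left (neg_le_abs w) hc⟩

theorem abs_smul_of_pos {c : ℝ} (hc : 0 < c) (w : V) : |c • w| = c • |w| := by
  refine le_antisymm (abs_smul_le hc.le w) ?_
  have h := smul_le_smul_of_nonneg_left (abs_smul_le (inv_nonneg.2 hc.le) (c • w)) hc.le
  rwa [inv_smul_smul₀ hc.ne', smul_inv_smul₀ hc.ne'] at h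

theorem posPart_smul_of_pos {c : ℝ} (hc : 0 < c) (w : V) : (c • w)⁺ = c • w⁺ := by
  have key : ∀ d : ℝ, 0 < d → ∀ v : V, (d • v)⁺ ≤ d • v⁺ := fun d hd v =>
    sup_le (smul_le_smul_of_nonneg_left (le_posPart v) hd.le)
      (smul_nonneg hd.le (posPart_nonneg v))
  refine le_antisymm (key c hc w) ?_
  have h := smul_le_smul_of_nonneg_left (key _ (inv_pos.2 hc) (c • w)) hc.le
  rwa [inv_smul_smul₀ hc.ne', smul_inv_smul₀ hc.ne'] at h

theorem smul_inf_smul_eq_zero {a b : V} (ha : 0 ≤ a) (hb : 0 ≤ b) (h : a ⊓ b = 0) {c d : ℝ}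
    (hc : 0 ≤ c) (hd : 0 ≤ d) : (c • a) ⊓ (d • b) = 0 := by
  refine le_antisymm ?_ (le_inf (smul_nonneg hc ha) (smul_nonneg hd hb))
  have hm : 0 < max c d + 1 := by positivity
  have h1 : (max c d + 1)⁻¹ • ((c • a) ⊓ (d • b)) ≤ a ⊓ b := by
    refine le_inf ?_ ?_
    · rw [inv_smul_le_iff_of_pos hm]
      exact inf_le_left.trans
        (smul_le_smul_of_nonneg_right ((le_max_left c d).trans (by simp)) ha)
    · rw [inv_smul_le_iff_of_pos hm]
      exact inf_le_right.trans
        (smul_le_smul_of_nonneg_right ((le_max_right c d).trans (by simp)) hb)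
  rwa [h, inv_smul_le_iff_of_pos hm, smul_zero] at h1

/-- The (order) ideal generated by an element. -/
def principalIdeal (u : V) : Submodule ℝ V where
  carrier := {w | ∃ c : ℝ, 0 ≤ c ∧ |w| ≤ c • |u|}
  zero_mem' := ⟨0, le_rfl, by simp⟩
  add_mem' := by
    rintro v w ⟨c, hc, hv⟩ ⟨d, hd, hw⟩
    exact ⟨c + d, add_nonneg hc hd, (abs_add_le v w).trans (by
      rw [add_smul]; exact add_le_add hv hw)⟩
  smul_mem' := by
    have key : ∀ t : ℝ, 0 ≤ t → ∀ w : V, (∃ c : ℝ, 0 ≤ c ∧ |w| ≤ c • |u|) →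
        ∃ c : ℝ, 0 ≤ c ∧ |t • w| ≤ c • |u| := by
      rintro t ht w ⟨c, hc, hw⟩
      refine ⟨t * c, mul_nonneg ht hc, (abs_smul_le ht w).trans ?_⟩
      rw [mul_smul]
      exact smul_le_smul_of_nonneg_left hw ht
    intro t w hw
    rcases le_total 0 t with ht | ht
    · exact key t ht w hw
    · have := key (-t) (neg_nonneg.2 ht) w hw
      rwa [neg_smul, abs_neg] at this

theorem mem_principalIdeal_of_abs_le {u w : V} (h : |w| ≤ |u|) : w ∈ principalIdeal u :=
  ⟨1, zero_le_one, by rwa [one_smul]⟩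

theorem mem_principalIdeal_mono {u v w : V} (hw : w ∈ principalIdeal u) (h : |v| ≤ |w|) :
    v ∈ principalIdeal u := by
  obtain ⟨c, hc, hw⟩ := hw
  exact ⟨c, hc, h.trans hw⟩

theorem abs_inf_abs_eq_zero_of_mem_principalIdeal {u v a b : V} (h : |u| ⊓ |v| = 0)
    (ha : a ∈ principalIdeal u) (hb : b ∈ principalIdeal v) : |a| ⊓ |b| = 0 := by
  obtain ⟨c, hc, ha⟩ := ha
  obtain ⟨d, hd, hb⟩ := hb
  exact inf_eq_zero_mono (abs_nonneg a) (abs_nonneg b) ha hb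
    (smul_inf_smul_eq_zero (abs_nonneg u) (abs_nonneg v) h hc hd)

/-- The terms `(xₙ - 4ⁿ ∑_{i<n} xᵢ - 2⁻ⁿ x)⁺` are disjoint as soon as `2⁻ⁿ xₙ ≤ x` for all `n`. -/
theorem isDisjointSeq_posPart {x : ℕ → V} {s : V} (hx : ∀ n, 0 ≤ x n)
    (hs : ∀ n, (2⁻¹ : ℝ) ^ n • x n ≤ s) :
    IsDisjointSeq fun n => (x n - (4 : ℝ) ^ n • ∑ i ∈ Finset.range n, x i - (2⁻¹ : ℝ) ^ n • s)⁺ := by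
  have hs0 : 0 ≤ s := (smul_nonneg (by positivity) (hx 0)).trans (hs 0)
  suffices h : ∀ m n, m < n →
      (x m - (4 : ℝ) ^ m • ∑ i ∈ Finset.range m, x i - (2⁻¹ : ℝ) ^ m • s)⁺ ⊓
      (x n - (4 : ℝ) ^ n • ∑ i ∈ Finset.range n, x i - (2⁻¹ : ℝ) ^ n • s)⁺ = 0 by
    intro m n hmn
    rw [abs_of_nonneg (posPart_nonneg _), abs_of_nonneg (posPart_nonneg _)]
    rcases hmn.lt_or_gt with hlt | hlt
    · exact h m n hlt
    · rw [inf_comm]; exact h n m hlt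
  intro m n hmn
  have hsum : ∀ k, 0 ≤ (4 : ℝ) ^ k • ∑ i ∈ Finset.range k, x i := fun k =>
    smul_nonneg (by positivity) (Finset.sum_nonneg fun i _ => hx i)
  have h4 : (0 : ℝ) < (4⁻¹ : ℝ) ^ n := by positivity
  -- The m-th term lies below 4⁻ⁿ z⁻ because 4⁻ⁿ xₙ ≤ 2⁻ᵐ s, and the n-th below z⁺ because xₘ occurs
  -- in its sum; z⁺ and z⁻ are disjoint.
  let z := x n - (4 : ℝ) ^ n • x m
  refine inf_eq_zero_mono (posPart_nonneg _) (posPart_nonneg _)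
    (c := (4⁻¹ : ℝ) ^ n • z⁻) (d := (1 : ℝ) • z⁺) ?_ ?_
    (smul_inf_smul_eq_zero (negPart_nonneg _) (posPart_nonneg _) ?_ h4.le zero_le_one)
  · rw [← posPart_neg, ← posPart_smul_of_pos h4]
    refine posPart_mono ?_
    have e : (4⁻¹ : ℝ) ^ n • -z = x m - (4⁻¹ : ℝ) ^ n • x n := by
      simp only [z, neg_sub, smul_sub, smul_smul, ← mul_pow]
      norm_num
    rw [e]
    refine sub_le_sub (sub_le_self _ (hsum m)) ?_
    refine le_trans ?_ (smul_le_smul_of_nonneg_left (hs n) (by positivity))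
    rw [smul_smul]
    refine smul_le_smul_of_nonneg_right ?_ (hx n)
    have h2 : (4⁻¹ : ℝ) ^ n = (2⁻¹ : ℝ) ^ n * (2⁻¹ : ℝ) ^ n := by
      rw [← mul_pow]; norm_num
    rw [h2]
    exact mul_le_mul_of_nonneg_right
      (pow_le_pow_of_le_one (by norm_num) (by norm_num) hmn.le) (by positivity)
  · rw [one_smul]
    refine posPart_mono ((sub_le_self _ (smul_nonneg (by positivity) hs0)).trans ?_)
    refine sub_le_sub_left (smul_le_smul_of_nonneg_left ?_ (by positivity)) _
    exact Finset.single_le_sum (f := x) (fun i _ => hx i) (Finset.mem_range.2 hmn)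
  · rw [inf_comm]; exact posPart_inf_negPart_eq_zero z

end Smul

/-! ### The modulus of a functional over an ideal. -/

section RestrictedModulus

variable {E : Type*} [NormedAddCommGroup E] [NormedSpace ℝ E] [Lattice E]

/-- The supremum of a functional over the elements `w` of a subspace with `|w| ≤ z`. For an order
ideal `I` and `0 ≤ z` this is the modulus of the restriction of the functional to `I`, extended by
the least positive extension. -/
noncomputable def restrictedModulus (I : Submodule ℝ E) (f : StrongDual ℝ E) (z : E) : ℝ :=
  sSup (f '' {w | w ∈ I ∧ |w| ≤ z})

variable [IsOrderedAddMonoid E] [HasSolidNorm E] {I : Submodule ℝ E} {f : StrongDual ℝ E}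

theorem apply_le_of_abs_le {w z : E} (h : |w| ≤ z) : f w ≤ ‖f‖ * ‖z‖ :=
  (le_abs_self _).trans <| (f.le_opNorm w).trans <| mul_le_mul_of_nonneg_left
    (norm_le_norm_of_abs_le_abs (h.trans (le_abs_self z))) (norm_nonneg f)

theorem apply_le_restrictedModulus {w z : E} (hw : w ∈ I) (h : |w| ≤ z) :
    f w ≤ restrictedModulus I f z :=
  le_csSup ⟨‖f‖ * ‖z‖, by rintro _ ⟨v, ⟨-, hv⟩, rfl⟩; exact apply_le_of_abs_le hv⟩
    ⟨w, ⟨hw, h⟩, rfl⟩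

theorem abs_apply_le_restrictedModulus {w z : E} (hw : w ∈ I) (h : |w| ≤ z) :
    |f w| ≤ restrictedModulus I f z :=
  abs_le'.2 ⟨apply_le_restrictedModulus hw h, by
    rw [← map_neg]
    exact apply_le_restrictedModulus (I.neg_mem hw) (by rwa [abs_neg])⟩

theorem restrictedModulus_le {z : E} (hz : 0 ≤ z) {b : ℝ}
    (h : ∀ w ∈ I, |w| ≤ z → f w ≤ b) : restrictedModulus I f z ≤ b :=
  csSup_le ⟨f 0, 0, ⟨I.zero_mem, by simpa using hz⟩, rfl⟩ (by
    rintro _ ⟨w, ⟨hw, hwz⟩, rfl⟩; exact h w hw hwz)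

theorem restrictedModulus_nonneg {z : E} (hz : 0 ≤ z) : 0 ≤ restrictedModulus I f z := by
  have := apply_le_restrictedModulus (f := f) I.zero_mem (by simpa using hz : |(0 : E)| ≤ z)
  simpa using this

theorem restrictedModulus_le_norm {z : E} (hz : 0 ≤ z) :
    restrictedModulus I f z ≤ ‖f‖ * ‖z‖ :=
  restrictedModulus_le hz fun _ _ h => apply_le_of_abs_le h

theorem restrictedModulus_mono {y z : E} (hy : 0 ≤ y) (hyz : y ≤ z) :
    restrictedModulus I f y ≤ restrictedModulus I f z :=
  restrictedModulus_le hy fun _ hw h => apply_le_restrictedModulus hw (h.trans hyz)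

/-- Riesz decomposition splits each competitor; solidity of `I` keeps the pieces in `I`. -/
theorem restrictedModulus_add_le (hI : ∀ v w : E, w ∈ I → |v| ≤ |w| → v ∈ I) {y z : E}
    (hy : 0 ≤ y) (hz : 0 ≤ z) :
    restrictedModulus I f (y + z) ≤ restrictedModulus I f y + restrictedModulus I f z := by
  refine restrictedModulus_le (add_nonneg hy hz) fun w hw h => ?_
  obtain ⟨u, v, rfl, hu, hv, huw⟩ := exists_riesz_decomposition hy hz h
  have huI := hI u _ hw huw
  rw [map_add]
  exact add_le_add (apply_le_restrictedModulus huI hu)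
    (apply_le_restrictedModulus ((I.add_mem_iff_right huI).1 hw) hv)

theorem le_restrictedModulus_add {y z : E} (hy : 0 ≤ y) (hz : 0 ≤ z) :
    restrictedModulus I f y + restrictedModulus I f z ≤ restrictedModulus I f (y + z) := by
  rw [← le_sub_iff_add_le]
  refine restrictedModulus_le hy fun v hv hvy => ?_
  rw [le_sub_comm]
  refine restrictedModulus_le hz fun w hw hwz => ?_
  rw [le_sub_iff_add_le', ← map_add]
  exact apply_le_restrictedModulus (I.add_mem hv hw) ((abs_add_le v w).trans (add_le_add hvy hwz))

theorem restrictedModulus_smul [IsOrderedModule ℝ E] {c : ℝ} (hc : 0 < c) {z : E} (hz : 0 ≤ z) :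
    restrictedModulus I f (c • z) = c * restrictedModulus I f z := by
  have key : ∀ d : ℝ, 0 < d → ∀ y : E, 0 ≤ y →
      restrictedModulus I f (d • y) ≤ d * restrictedModulus I f y := by
    intro d hd y hy
    refine restrictedModulus_le (smul_nonneg hd.le hy) fun w hw h => ?_
    rw [← inv_mul_le_iff₀ hd, ← smul_eq_mul, ← map_smul]
    refine apply_le_restrictedModulus (I.smul_mem _ hw) ?_
    rw [abs_smul_of_pos (inv_pos.2 hd)]
    exact (inv_smul_le_iff_of_pos hd).2 h
  refine le_antisymm (key c hc z hz) ?_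
  have h := key _ (inv_pos.2 hc) (c • z) (smul_nonneg hc.le hz)
  rwa [inv_smul_smul₀ hc.ne', le_inv_mul_iff₀ hc] at h

theorem exists_lt_apply_of_restrictedModulus {z : E} (hz : 0 ≤ z) {η : ℝ} (hη : 0 < η) :
    ∃ w ∈ I, |w| ≤ z ∧ restrictedModulus I f z - η < f w := by
  by_contra! h
  have := restrictedModulus_le (f := f) hz h
  linarith

variable [IsOrderedModule ℝ E]

/-- The value is attained at `x`, not at |x|: in the domination argument only the sequence itself,
not its moduli, is known to be weakly p-summable. -/
theorem exists_apply_eq_restrictedModulus_abs (f : StrongDual ℝ E) (u x : E) :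
    ∃ h : StrongDual ℝ E, h x = restrictedModulus (principalIdeal u) f |x| ∧
      ∀ z, |h z| ≤ restrictedModulus (principalIdeal u) f |z| := by
  obtain ⟨h, hx, hle⟩ := exists_le_sublinear_apply_eq
    (N := fun z => restrictedModulus (principalIdeal u) f |z|) (C := ‖f‖)
    (fun c hc z => by
      simp only [abs_smul_of_pos hc, restrictedModulus_smul hc (abs_nonneg z)])
    (fun y z => (restrictedModulus_mono (abs_nonneg _) (abs_add_le y z)).trans
      (restrictedModulus_add_le (fun _ _ => mem_principalIdeal_mono) (abs_nonneg y) (abs_nonneg z)))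
    (fun z => by
      rw [← norm_abs_eq_norm z]; exact restrictedModulus_le_norm (abs_nonneg z)) x
  refine ⟨h, hx, fun z => abs_le'.2 ⟨hle z, ?_⟩⟩
  have := hle (-z)
  rwa [map_neg, abs_neg] at this

/-- Using z⁺ in the majorant forces positivity, since it vanishes at -z for z ≥ 0. -/
theorem exists_positive_apply_eq_restrictedModulus (f : StrongDual ℝ E) (u : E) {x : E}
    (hx : 0 ≤ x) :
    ∃ g : StrongDual ℝ E, (∀ z, 0 ≤ z → 0 ≤ g z) ∧
      g x = restrictedModulus (principalIdeal u) f x ∧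
      ∀ z, 0 ≤ z → g z ≤ restrictedModulus (principalIdeal u) f z := by
  obtain ⟨g, hgx, hle⟩ := exists_le_sublinear_apply_eq
    (N := fun z => restrictedModulus (principalIdeal u) f z⁺) (C := ‖f‖)
    (fun c hc z => by
      simp only [posPart_smul_of_pos hc, restrictedModulus_smul hc (posPart_nonneg z)])
    (fun y z => (restrictedModulus_mono (posPart_nonneg _) (posPart_add_le y z)).trans
      (restrictedModulus_add_le (fun _ _ => mem_principalIdeal_mono) (posPart_nonneg y)
        (posPart_nonneg z)))
    (fun z => by
      refine (restrictedModulus_le_norm (posPart_nonneg z)).trans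
        (mul_le_mul_of_nonneg_left (norm_le_norm_of_abs_le_abs ?_) (norm_nonneg f))
      rw [abs_of_nonneg (posPart_nonneg z)]
      exact sup_le (le_abs_self z) (abs_nonneg z)) x
  have h0 : restrictedModulus (principalIdeal u) f (0 : E) = 0 := by
    refine le_antisymm ?_ (restrictedModulus_nonneg le_rfl)
    simpa using restrictedModulus_le_norm (I := principalIdeal u) (f := f) (le_refl (0 : E))
  refine ⟨g, fun z hz => ?_, ?_, fun z hz => ?_⟩
  · have := hle (-z)
    simp only [posPart_neg, negPart_of_nonneg hz, h0, map_neg] at this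
    linarith
  · simpa [posPart_of_nonneg hx] using hgx
  · simpa [posPart_of_nonneg hz] using hle z

end RestrictedModulus

/-! ### Weak* null and weakly p-summable sequences. -/

section Dual

variable {X : Type*} [NormedAddCommGroup X] [NormedSpace ℝ X]

theorem isWeakStarNull_iff {f : ℕ → StrongDual ℝ X} :
    IsWeakStarNull f ↔ ∀ x, Tendsto (fun n => f n x) atTop (𝓝 0) :=
  tendsto_iff_forall_eval_tendsto_topDualPairing

theorem IsWeakStarNull.comp {f : ℕ → StrongDual ℝ X} (hf : IsWeakStarNull f) {θ : ℕ → ℕ}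
    (hθ : Tendsto θ atTop atTop) : IsWeakStarNull (f ∘ θ) :=
  isWeakStarNull_iff.2 fun x => (isWeakStarNull_iff.1 hf x).comp hθ

theorem IsWeakStarNull.exists_norm_le [CompleteSpace X] {f : ℕ → StrongDual ℝ X}
    (hf : IsWeakStarNull f) : ∃ C, ∀ n, ‖f n‖ ≤ C :=
  banach_steinhaus fun x => by
    obtain ⟨C, hC⟩ := (isWeakStarNull_iff.1 hf x).norm.bddAbove_range
    exact ⟨C, fun n => hC ⟨n, rfl⟩⟩

theorem exists_frequently_of_not_tendstoUniformlyOn {f : ℕ → StrongDual ℝ X} {A : Set X}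
    (h : ¬ TendstoUniformlyOn (fun n x => f n x) (fun _ => 0) atTop A) :
    ∃ ε > 0, ∃ θ : ℕ → ℕ, StrictMono θ ∧ ∃ x : ℕ → X, ∀ n, x n ∈ A ∧ ε ≤ |f (θ n) (x n)| := by
  rw [Metric.tendstoUniformlyOn_iff] at h
  push Not at h
  obtain ⟨ε, hε, h⟩ := h
  obtain ⟨θ, hθ, hx⟩ := extraction_of_frequently_atTop h
  choose x hxA hx using hx
  refine ⟨ε, hε, θ, hθ, x, fun n => ⟨hxA n, ?_⟩⟩
  simpa [dist_eq_norm] using hx n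

theorem tendsto_apply_of_tendstoUniformlyOn {f : ℕ → StrongDual ℝ X} {A : Set X}
    (h : TendstoUniformlyOn (fun n x => f n x) (fun _ => 0) atTop A) {x : ℕ → X}
    (hx : ∀ n, x n ∈ A) : Tendsto (fun n => f n (x n)) atTop (𝓝 0) := by
  rw [Metric.tendstoUniformlyOn_iff] at h
  rw [Metric.tendsto_atTop']
  intro ε hε
  obtain ⟨N, hN⟩ := eventually_atTop.1 (h ε hε)
  exact ⟨N, fun n hn => by simpa [dist_comm] using hN n hn.le (x n) (hx n)⟩

variable {p : ℝ}

theorem IsWeaklyPSummable.comp_injective {x : ℕ → X} (hx : IsWeaklyPSummable p x) {θ : ℕ → ℕ}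
    (hθ : Function.Injective θ) : IsWeaklyPSummable p (x ∘ θ) := fun φ =>
  (hx φ).comp_injective hθ

theorem IsWeaklyPSummable.exists_norm_le {x : ℕ → X} (hp : 0 < p) (hx : IsWeaklyPSummable p x) :
    ∃ C, ∀ n, ‖x n‖ ≤ C := by
  obtain ⟨C, hC⟩ := banach_steinhaus
    (g := fun n => NormedSpace.inclusionInDoubleDual ℝ X (x n)) fun φ => by
      obtain ⟨C, hC⟩ := (hx φ).tendsto_atTop_zero.bddAbove_range
      refine ⟨C ^ p⁻¹, fun n => ?_⟩
      rw [NormedSpace.dual_def, Real.norm_eq_abs, ← Real.rpow_rpow_inv (abs_nonneg _) hp.ne']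
      exact Real.rpow_le_rpow (by positivity) (hC ⟨n, rfl⟩) (by positivity)
  refine ⟨C, fun n => ?_⟩
  rw [← (NormedSpace.inclusionInDoubleDualLi ℝ).norm_map (x n)]
  exact hC n

/-- Uniform boundedness for the truncated operators φ ↦ (φ(xₙ))ₙ from the dual into ℓᵖ. -/
theorem IsWeaklyPSummable.exists_sum_le {x : ℕ → X} (hp : 1 ≤ p) (hx : IsWeaklyPSummable p x) :
    ∃ C, 0 ≤ C ∧ ∀ (φ : StrongDual ℝ X) (N : ℕ),
      ∑ n ∈ Finset.range N, |φ (x n)| ^ p ≤ (C * ‖φ‖) ^ p := by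
  have hp0 : 0 < p := one_pos.trans_le hp
  have htoReal : (ENNReal.ofReal p).toReal = p := ENNReal.toReal_ofReal hp0.le
  have : Fact (1 ≤ ENNReal.ofReal p) := ⟨by simpa using hp⟩
  let T : (N : ℕ) → StrongDual ℝ X →L[ℝ] lp (fun _ : ℕ => ℝ) (ENNReal.ofReal p) := fun N =>
    ∑ n ∈ Finset.range N, (lp.singleContinuousLinearMap ℝ (fun _ : ℕ => ℝ) (ENNReal.ofReal p) n).comp
      (NormedSpace.inclusionInDoubleDual ℝ X (x n))
  have hT : ∀ N φ, ‖T N φ‖ ^ p = ∑ n ∈ Finset.range N, |φ (x n)| ^ p := by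
    intro N φ
    have := lp.norm_sum_single (E := fun _ : ℕ => ℝ) (p := ENNReal.ofReal p)
      (by rwa [htoReal]) (fun n => φ (x n)) (Finset.range N)
    rw [htoReal] at this
    simpa [T] using this
  obtain ⟨C, hC⟩ := banach_steinhaus (g := T) fun φ => by
    refine ⟨(∑' n, |φ (x n)| ^ p) ^ p⁻¹, fun N => ?_⟩
    rw [← Real.rpow_rpow_inv (norm_nonneg (T N φ)) hp0.ne', hT]
    refine Real.rpow_le_rpow (Finset.sum_nonneg fun n _ => by positivity)
      ((hx φ).sum_le_tsum _ fun n _ => by positivity) (by positivity)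
  refine ⟨C, (norm_nonneg _).trans (hC 0), fun φ N => ?_⟩
  rw [← hT]
  exact Real.rpow_le_rpow (norm_nonneg _) ((T N).le_of_opNorm_le (hC N) φ) hp0.le

/-- The range of a weakly `p`-summable sequence that contains zero is weakly `p`-compact. -/
theorem IsWeaklyPSummable.isWeaklyPCompact_range {x : ℕ → X} (hp : p ≠ 0)
    (hx : IsWeaklyPSummable p x) (h0 : 0 ∈ Set.range x) : IsWeaklyPCompact p (Set.range x) := by
  intro z hz
  choose i hi using hz
  -- Either an index recurs, giving a constant subsequence, or the indices tend to infinity and the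
  -- limit is 0.
  by_cases h : ∃ m, ∃ᶠ k in atTop, i k = m
  · obtain ⟨m, hm⟩ := h
    obtain ⟨θ, hθ, hm⟩ := extraction_of_frequently_atTop hm
    refine ⟨x m, ⟨m, rfl⟩, θ, hθ, fun φ => ?_⟩
    simp [← hi, hm, Real.zero_rpow hp, summable_zero]
  · push Not at h
    have hi' : Tendsto i atTop atTop := by
      rw [← Nat.cofinite_eq_atTop]
      refine Tendsto.cofinite_of_finite_preimage_singleton fun m => ?_
      have := h m
      rw [← Nat.cofinite_eq_atTop] at this
      simpa [Filter.Eventually, Set.compl_def] using! this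
    obtain ⟨θ, hθ, hiθ⟩ := strictMono_subseq_of_tendsto_atTop hi'
    refine ⟨0, h0, θ, hθ, ?_⟩
    have := hx.comp_injective hiθ.injective
    simpa [Function.comp_def, hi] using this

theorem IsWeaklyPCompact.isBounded {K : Set X} (hp : 0 < p) (hK : IsWeaklyPCompact p K) :
    Bornology.IsBounded K := by
  by_contra h
  have hex : ∀ n : ℕ, ∃ x ∈ K, (n : ℝ) < ‖x‖ := by
    intro n
    by_contra! hn
    exact h (isBounded_iff_forall_norm_le.2 ⟨n, hn⟩)
  choose x hxK hx using hex
  obtain ⟨a, -, θ, hθ, hs⟩ := hK x hxK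
  obtain ⟨C, hC⟩ := hs.exists_norm_le hp
  obtain ⟨n, hn⟩ := exists_nat_gt (C + ‖a‖)
  have h1 := norm_le_norm_add_norm_sub' (x (θ n)) a
  have h2 : (n : ℝ) ≤ θ n := by exact_mod_cast hθ.id_le n
  linarith [hC n, hx (θ n)]

end Dual

/-! ### Domination by weakly p-summable sequences. -/

variable {E : Type*} [NormedAddCommGroup E] [NormedSpace ℝ E] [Lattice E] [IsOrderedAddMonoid E]
  [IsOrderedModule ℝ E] [HasSolidNorm E]

theorem IsDisjointSeq.comp_injective {x : ℕ → E} (hx : IsDisjointSeq x) {θ : ℕ → ℕ}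
    (hθ : Function.Injective θ) : IsDisjointSeq (x ∘ θ) := fun _ _ h => hx _ _ (hθ.ne h)

theorem IsDisjointSeq.mono {x y : ℕ → E} (hx : IsDisjointSeq x) (h : ∀ n, |y n| ≤ |x n|) :
    IsDisjointSeq y := fun m n hmn =>
  inf_eq_zero_mono (abs_nonneg _) (abs_nonneg _) (h m) (h n) (hx m n hmn)

/-- Near-maximizers taken from disjoint ideals are disjoint and bounded by `z`, so their sum still
has modulus at most `z`. -/
theorem sum_restrictedModulus_le (φ : StrongDual ℝ E) {y : ℕ → E} (hd : IsDisjointSeq y)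
    (s : Finset ℕ) {z : E} (hz : 0 ≤ z) :
    ∑ n ∈ s, restrictedModulus (principalIdeal (y n)) φ z ≤ ‖φ‖ * ‖z‖ := by
  refine le_of_forall_pos_le_add fun δ hδ => ?_
  have hη : 0 < δ / (s.card + 1) := by positivity
  choose w hwI hwz hw using fun n =>
    exists_lt_apply_of_restrictedModulus (I := principalIdeal (y n)) (f := φ) hz hη
  have h1 : ∑ n ∈ s, restrictedModulus (principalIdeal (y n)) φ z ≤
      ∑ n ∈ s, (φ (w n) + δ / (s.card + 1)) :=
    Finset.sum_le_sum fun n _ => by linarith [hw n]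
  have h2 : φ (∑ n ∈ s, w n) ≤ ‖φ‖ * ‖z‖ :=
    apply_le_of_abs_le <| (abs_sum_le s w).trans <|
      sum_le_of_disjoint s hz (fun i => abs_nonneg (w i)) hwz fun i j hij =>
        abs_inf_abs_eq_zero_of_mem_principalIdeal (hd i j hij) (hwI i) (hwI j)
  have h3 : (s.card : ℝ) * (δ / (s.card + 1)) ≤ δ := by
    rw [mul_div_assoc', div_le_iff₀ (by positivity)]
    nlinarith
  rw [Finset.sum_add_distrib, Finset.sum_const, nsmul_eq_mul, ← map_sum] at h1
  linarith

/-- A disjoint sequence dominated by a weakly `p`-summable sequence is weakly `p`-summable. -/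
theorem IsWeaklyPSummable.of_disjoint_of_abs_le {p : ℝ} (hp : 1 ≤ p) {x y : ℕ → E}
    (hx : IsWeaklyPSummable p x) (hd : IsDisjointSeq y) (hyx : ∀ n, |y n| ≤ |x n|) :
    IsWeaklyPSummable p y := by
  intro φ
  have hp0 : 0 ≤ p := by linarith
  obtain ⟨C, hC0, hC⟩ := hx.exists_sum_le hp
  choose h hhx hh using fun n => exists_apply_eq_restrictedModulus_abs φ (y n) (x n)
  refine summable_of_sum_range_le (c := (C * ‖φ‖) ^ p) (fun n => by positivity) fun N => ?_
  obtain ⟨ε, hε, hsum⟩ := exists_signs hp (fun m n => h n (x m)) N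
  -- One functional absorbs all the `h n`: disjointness of the ideals bounds its norm by ‖φ‖ for any
  -- signs, and the chosen signs recover the diagonal terms.
  let ψ : StrongDual ℝ E := ∑ n ∈ Finset.range N, ε n • h n
  have hψ : ∀ z, ψ z = ∑ n ∈ Finset.range N, ε n * h n z := fun z => by simp [ψ]
  have hψn : ‖ψ‖ ≤ ‖φ‖ := by
    refine ψ.opNorm_le_bound (norm_nonneg φ) fun z => ?_
    rw [hψ, Real.norm_eq_abs, ← norm_abs_eq_norm z]
    refine (Finset.abs_sum_le_sum_abs _ _).trans (le_trans (Finset.sum_le_sum fun n _ => ?_)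
      (sum_restrictedModulus_le φ hd (Finset.range N) (abs_nonneg z)))
    rw [abs_mul, hε, one_mul]
    exact hh n z
  calc ∑ n ∈ Finset.range N, |φ (y n)| ^ p
      ≤ ∑ n ∈ Finset.range N, |h n (x n)| ^ p := by
        refine Finset.sum_le_sum fun n _ => Real.rpow_le_rpow (abs_nonneg _) ?_ hp0
        refine le_trans ?_ (le_abs_self _)
        rw [hhx]
        exact abs_apply_le_restrictedModulus (mem_principalIdeal_of_abs_le le_rfl) (hyx n)
    _ ≤ ∑ m ∈ Finset.range N, |ψ (x m)| ^ p := by simpa only [hψ] using hsum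
    _ ≤ (C * ‖ψ‖) ^ p := hC ψ N
    _ ≤ (C * ‖φ‖) ^ p := Real.rpow_le_rpow (by positivity)
        (mul_le_mul_of_nonneg_left hψn hC0) hp0

/-! ### From positive to disjoint. -/

variable [CompleteSpace E]

/-- Otherwise Rosenthal's lemma yields an infinite `M` with |fₙ(s(M \ {n}))| ≤ ε/2 for n ∈ M; since
fₙ(s M) → 0, this contradicts |fₙ(yₙ)| ≥ ε. -/
theorem IsWeakStarNull.tendsto_apply_of_disjoint_of_nonneg (hE : IsSigmaDedekindComplete E)
    {f : ℕ → StrongDual ℝ E} (hf : IsWeakStarNull f) {y : ℕ → E} {x : E}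
    (hd : IsDisjointSeq y) (hy : ∀ n, 0 ≤ y n) (hyx : ∀ n, y n ≤ x) :
    Tendsto (fun n => f n (y n)) atTop (𝓝 0) := by
  obtain ⟨s, hs, hsy, hadd⟩ :=
    exists_additive_sup_of_isSigmaDedekindComplete hE ((hy 0).trans (hyx 0)) hy hyx hd
  obtain ⟨C, hC⟩ := hf.exists_norm_le
  by_contra hnot
  rw [Metric.tendsto_atTop'] at hnot
  push Not at hnot
  obtain ⟨ε, hε, hfreq⟩ := hnot
  have hinf : {n | ε ≤ |f n (y n)|}.Infinite := by
    rw [Set.infinite_iff_exists_gt]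
    intro a
    obtain ⟨n, hn, h⟩ := hfreq a
    exact ⟨n, by simpa [dist_eq_norm] using h, hn⟩
  obtain ⟨j, hj⟩ := exists_nat_gt (C * ‖x‖ / (ε / 2))
  rw [div_lt_iff₀ (by positivity)] at hj
  obtain ⟨M, hMN, hM, hMs⟩ := exists_infinite_subset_of_superadditive
    (ν := fun n A => restrictedModulus ⊤ (f n) (s A)) (half_pos hε).le
    (fun n A => restrictedModulus_nonneg (hs A).1)
    (fun n A B hAB => by
      simp only [hadd A B hAB]
      exact le_restrictedModulus_add (hs A).1 (hs B).1) j _ hinf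
    (fun n _ => by
      refine (restrictedModulus_mono (hs _).1 (hs _).2).trans (le_trans ?_ hj.le)
      exact (restrictedModulus_le_norm ((hs ∅).1.trans (hs ∅).2)).trans
        (mul_le_mul_of_nonneg_right (hC n) (norm_nonneg x)))
  have hlim := Metric.tendsto_atTop'.1 (isWeakStarNull_iff.1 hf (s M)) (ε / 2) (half_pos hε)
  obtain ⟨N, hN⟩ := hlim
  obtain ⟨n, hnM, hn⟩ := hM.exists_gt N
  have h1 : s M = s (M \ {n}) + y n := by
    rw [← hsy, ← hadd _ _ Set.disjoint_sdiff_left,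
      Set.sdiff_union_of_subset (Set.singleton_subset_iff.2 hnM)]
  have h2 : |f n (s (M \ {n}))| ≤ ε / 2 :=
    (abs_apply_le_restrictedModulus Submodule.mem_top (abs_of_nonneg (hs _).1).le).trans (hMs n hnM)
  have h3 : |f n (s M)| < ε / 2 := by simpa [dist_eq_norm] using hN n hn
  have h4 : ε ≤ |f n (y n)| := hMN hnM
  have h5 : f n (y n) = f n (s M) - f n (s (M \ {n})) := by rw [h1, map_add]; ring
  rw [h5] at h4
  linarith [abs_sub (f n (s M)) (f n (s (M \ {n})))]

/-- In a `σ`-Dedekind complete Banach lattice, a weak* null sequence of functionals tends to zero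
along every order bounded disjoint sequence. -/
theorem IsWeakStarNull.tendsto_apply_of_disjoint (hE : IsSigmaDedekindComplete E)
    {f : ℕ → StrongDual ℝ E} (hf : IsWeakStarNull f) {y : ℕ → E} {x : E}
    (hd : IsDisjointSeq y) (hyx : ∀ n, |y n| ≤ x) :
    Tendsto (fun n => f n (y n)) atTop (𝓝 0) := by
  have hpos : ∀ n, (y n)⁺ ≤ |y n| := fun n => sup_le (le_abs_self _) (abs_nonneg _)
  have hneg : ∀ n, (y n)⁻ ≤ |y n| := fun n => sup_le (neg_le_abs _) (abs_nonneg _)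
  have h1 := hf.tendsto_apply_of_disjoint_of_nonneg hE
    (hd.mono (y := fun n => (y n)⁺) fun n => by
      rw [abs_of_nonneg (posPart_nonneg _)]; exact hpos n)
    (fun n => posPart_nonneg _) fun n => (hpos n).trans (hyx n)
  have h2 := hf.tendsto_apply_of_disjoint_of_nonneg hE
    (hd.mono (y := fun n => (y n)⁻) fun n => by
      rw [abs_of_nonneg (negPart_nonneg _)]; exact hneg n)
    (fun n => negPart_nonneg _) fun n => (hneg n).trans (hyx n)
  have h3 := h1.sub h2
  simpa only [← map_sub, posPart_sub_negPart, sub_zero] using h3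

/-- A weak* null sequence can be replaced by a positive weak* null sequence that dominates it
along a given disjoint sequence. -/
theorem IsWeakStarNull.exists_positive_of_disjoint (hE : IsSigmaDedekindComplete E)
    {f : ℕ → StrongDual ℝ E} (hf : IsWeakStarNull f) {x : ℕ → E} (hd : IsDisjointSeq x) :
    ∃ g : ℕ → StrongDual ℝ E, (∀ n, ∀ z, 0 ≤ z → 0 ≤ g n z) ∧ IsWeakStarNull g ∧
      ∀ n, |f n (x n)| ≤ g n |x n| := by
  choose g hg hgx hgz using fun n =>
    exists_positive_apply_eq_restrictedModulus (f n) (x n) (abs_nonneg (x n))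
  have hlim : ∀ z, 0 ≤ z → Tendsto (fun n => g n z) atTop (𝓝 0) := by
    intro z hz
    choose w hwI hwz hw using fun n : ℕ =>
      exists_lt_apply_of_restrictedModulus (I := principalIdeal (x n)) (f := f n) hz
        (Nat.one_div_pos_of_nat (α := ℝ) (n := n))
    have h1 := hf.tendsto_apply_of_disjoint hE (y := w) (fun m n hmn =>
      abs_inf_abs_eq_zero_of_mem_principalIdeal (hd m n hmn) (hwI m) (hwI n)) hwz
    have h2 := h1.add (tendsto_one_div_add_atTop_nhds_zero_nat (𝕜 := ℝ))
    rw [add_zero] at h2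
    exact squeeze_zero (fun n => hg n z hz)
      (fun n => by linarith [hgz n z hz, hw n]) h2
  refine ⟨g, hg, isWeakStarNull_iff.2 fun z => ?_, fun n => ?_⟩
  · have := (hlim _ (posPart_nonneg z)).sub (hlim _ (negPart_nonneg z))
    simpa only [← map_sub, posPart_sub_negPart, sub_zero] using this
  · rw [hgx]
    exact abs_apply_le_restrictedModulus (mem_principalIdeal_of_abs_le le_rfl) le_rfl

theorem HasPositiveDPStar.hasDisjointDPStar (hE : IsSigmaDedekindComplete E) {p : ℝ} (hp : 1 ≤ p)
    (h : HasPositiveDPStar p E) : HasDisjointDPStar p E := by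
  intro x hd hx f hf
  by_contra hnot
  obtain ⟨ε, hε, θ, hθ, y, hy⟩ := exists_frequently_of_not_tendstoUniformlyOn hnot
  choose k hk using fun n => (hy n).1
  have hy : ∀ n, ε ≤ |f (θ n) (x (k n))| := fun n => by rw [hk]; exact (hy n).2
  -- Each fixed `x m` is hit finitely often, since the functionals tend to 0 there.
  have hk' : Tendsto k atTop atTop := by
    rw [← Nat.cofinite_eq_atTop]
    refine Tendsto.cofinite_of_finite_preimage_singleton fun m => ?_
    have := ((isWeakStarNull_iff.1 (hf.comp hθ.tendsto_atTop) (x m)).abs).eventually_lt_const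
      (by simpa using hε)
    rw [← Nat.cofinite_eq_atTop] at this
    refine this.subset fun n hn => ?_
    have hn : k n = m := hn
    have := hy n
    rw [hn] at this
    simpa using this
  obtain ⟨ψ, hψ, hkψ⟩ := strictMono_subseq_of_tendsto_atTop hk'
  obtain ⟨g, hg, hg0, hgx⟩ := (hf.comp (hθ.comp hψ).tendsto_atTop).exists_positive_of_disjoint hE
    (hd.comp_injective hkψ.injective)
  have habs : IsWeaklyPSummable p fun n => |x n| :=
    hx.of_disjoint_of_abs_le hp (hd.mono fun n => (abs_abs _).le) fun n => (abs_abs _).le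
  -- Prepending 0 puts the weak limit into the range.
  let u : ℕ → E := fun n => Nat.casesOn n 0 fun n => |x n|
  have hu : IsWeaklyPSummable p u := fun φ => (summable_nat_add_iff 1).1 (habs φ)
  have hK := (h _ (hu.isWeaklyPCompact_range (by linarith) ⟨0, rfl⟩)).2 g hg hg0
  have hlim := tendsto_apply_of_tendstoUniformlyOn hK (x := fun n => |x (k (ψ n))|)
    fun n => ⟨k (ψ n) + 1, rfl⟩
  exact hε.not_ge (ge_of_tendsto' hlim fun n => (hy (ψ n)).trans (hgx n))

/-! ### From disjoint to positive. -/

theorem exists_subseq_apply_sum_lt {f : ℕ → StrongDual ℝ E} (hf : IsWeakStarNull f)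
    (hpos : ∀ n, ∀ z : E, 0 ≤ z → 0 ≤ f n z) {x : ℕ → E} (hx : ∀ n, 0 ≤ x n) {δ : ℝ}
    (hδ : 0 < δ) : ∃ θ : ℕ → ℕ, StrictMono θ ∧
      ∀ n, f (θ n) ((4 : ℝ) ^ n • ∑ i ∈ Finset.range n, x (θ i)) < δ := by
  -- The full sum up to `N` is used so that the choice of `b` depends only on the last index; it
  -- dominates the sum over the earlier chosen indices.
  have hex : ∀ N, ∃ b > N, f b ((4 : ℝ) ^ (N + 1) • ∑ i ∈ Finset.range (N + 1), x i) < δ :=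
    fun N => ((eventually_gt_atTop N).and
      ((isWeakStarNull_iff.1 hf _).eventually_lt_const hδ)).exists
  choose b hb hbδ using hex
  let θ : ℕ → ℕ := fun n => b^[n] 0
  have hθ1 : ∀ n, θ (n + 1) = b (θ n) := fun n => Function.iterate_succ_apply' b n 0
  have hθ : StrictMono θ := strictMono_nat_of_lt_succ fun n => by rw [hθ1]; exact hb _
  refine ⟨θ, hθ, fun n => ?_⟩
  cases n with
  | zero => simpa using hδ
  | succ n =>
    refine lt_of_le_of_lt ?_ (hbδ (θ n))
    rw [hθ1, ← sub_nonneg, ← map_sub]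
    refine hpos _ _ (sub_nonneg.2 ?_)
    have hsum : ∑ i ∈ Finset.range (n + 1), x (θ i) ≤ ∑ i ∈ Finset.range (θ n + 1), x i := by
      rw [← Finset.sum_image (f := x) hθ.injective.injOn]
      refine Finset.sum_le_sum_of_subset_of_nonneg ?_ fun i _ _ => hx i
      intro i hi
      obtain ⟨m, hm, rfl⟩ := Finset.mem_image.1 hi
      have := hθ.monotone (Nat.le_of_lt_succ (Finset.mem_range.1 hm))
      exact Finset.mem_range.2 (by omega)
    refine (smul_le_smul_of_nonneg_left hsum (by positivity)).trans
      (smul_le_smul_of_nonneg_right ?_ (Finset.sum_nonneg fun i _ => hx i))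
    have : n ≤ θ n := hθ.id_le n
    exact pow_le_pow_right₀ (by norm_num) (by omega)

theorem HasDisjointDPStar.tendsto_apply {p : ℝ} (hp : 1 ≤ p) (h : HasDisjointDPStar p E)
    {f : ℕ → StrongDual ℝ E} (hf : IsWeakStarNull f) (hpos : ∀ n, ∀ z : E, 0 ≤ z → 0 ≤ f n z)
    {x : ℕ → E} (hx : IsWeaklyPSummable p x) {ε : ℝ} (hε : 0 < ε) :
    ¬ ∀ n, ε ≤ |f n (x n)| := by
  intro hfx
  obtain ⟨θ, hθ, hsmall⟩ := exists_subseq_apply_sum_lt hf hpos (x := fun n => |x n|)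
    (fun n => abs_nonneg _) (by positivity : 0 < ε / 4)
  obtain ⟨C, hC⟩ := hx.exists_norm_le (one_pos.trans_le hp)
  have hsummable : Summable fun n => (2⁻¹ : ℝ) ^ n • |x (θ n)| := by
    refine Summable.of_norm_bounded (g := fun n => (2⁻¹ : ℝ) ^ n * C)
      ((summable_geometric_of_lt_one (by norm_num) (by norm_num)).mul_right C) fun n => ?_
    rw [norm_smul, norm_abs_eq_norm, Real.norm_of_nonneg (by positivity)]
    exact mul_le_mul_of_nonneg_left (hC _) (by positivity)
  let s := ∑' n, (2⁻¹ : ℝ) ^ n • |x (θ n)|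
  have hnn : ∀ n, 0 ≤ (2⁻¹ : ℝ) ^ n • |x (θ n)| := fun n =>
    smul_nonneg (by positivity) (abs_nonneg _)
  have hs : ∀ n, (2⁻¹ : ℝ) ^ n • |x (θ n)| ≤ s := fun n =>
    hsummable.le_tsum n fun j _ => hnn j
  have hs0 : 0 ≤ s := (hnn 0).trans (hs 0)
  let v : ℕ → E := fun n =>
    |x (θ n)| - (4 : ℝ) ^ n • ∑ i ∈ Finset.range n, |x (θ i)| - (2⁻¹ : ℝ) ^ n • s
  have hd : IsDisjointSeq fun n => (v n)⁺ :=
    isDisjointSeq_posPart (x := fun n => |x (θ n)|) (fun n => abs_nonneg _) hs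
  have hv : ∀ n, v n ≤ |x (θ n)| := fun n =>
    (sub_le_self _ (smul_nonneg (by positivity) hs0)).trans
      (sub_le_self _ (smul_nonneg (by positivity) (Finset.sum_nonneg fun i _ => abs_nonneg _)))
  have hsum : IsWeaklyPSummable p fun n => (v n)⁺ :=
    (hx.comp_injective hθ.injective).of_disjoint_of_abs_le hp hd fun n => by
      rw [abs_of_nonneg (posPart_nonneg _)]
      exact sup_le (hv n) (abs_nonneg _)
  have hfθ := hf.comp hθ.tendsto_atTop
  have hlim := tendsto_apply_of_tendstoUniformlyOn (h _ hd hsum _ hfθ) (x := fun n => (v n)⁺)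
    fun n => ⟨n, rfl⟩
  -- Three quantities below ε/4, namely fₙ at vₙ⁺, at `s` and at the weighted partial sum, must
  -- together majorize fₙ|xₙ| ≥ ε along the subsequence.
  obtain ⟨n, hn1, hn2⟩ := ((hlim.eventually_lt_const (by positivity : 0 < ε / 4)).and
    ((isWeakStarNull_iff.1 hfθ s).eventually_lt_const (by positivity : 0 < ε / 4))).exists
  simp only [Function.comp_apply] at hn1 hn2
  have hmono : ∀ {a b : E}, a ≤ b → f (θ n) a ≤ f (θ n) b := fun {a b} hab => by
    have := hpos (θ n) _ (sub_nonneg.2 hab)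
    rwa [map_sub, sub_nonneg] at this
  have h1 : ε ≤ f (θ n) |x (θ n)| := (hfx (θ n)).trans (abs_le'.2
    ⟨hmono (le_abs_self _), by rw [← map_neg]; exact hmono (neg_le_abs _)⟩)
  have h2 := hmono (le_posPart (v n))
  have h3 : f (θ n) ((2⁻¹ : ℝ) ^ n • s) ≤ f (θ n) s := hmono (by
    simpa using smul_le_smul_of_nonneg_right
      (pow_le_one₀ (by norm_num) (by norm_num) : (2⁻¹ : ℝ) ^ n ≤ 1) hs0)
  have h4 := hsmall n
  have h5 : f (θ n) (v n) = f (θ n) |x (θ n)| -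
      f (θ n) ((4 : ℝ) ^ n • ∑ i ∈ Finset.range n, |x (θ i)|) - f (θ n) ((2⁻¹ : ℝ) ^ n • s) := by
    simp only [v, map_sub]
  linarith

theorem HasDisjointDPStar.hasPositiveDPStar {p : ℝ} (hp : 1 ≤ p) (h : HasDisjointDPStar p E) :
    HasPositiveDPStar p E := by
  intro K hK
  refine ⟨hK.isBounded (one_pos.trans_le hp), fun f hpos hf => ?_⟩
  by_contra hnot
  obtain ⟨ε, hε, θ, hθ, x, hx⟩ := exists_frequently_of_not_tendstoUniformlyOn hnot
  obtain ⟨a, -, ψ, hψ, hs⟩ := hK x fun n => (hx n).1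
  have hf' := hf.comp (hθ.comp hψ).tendsto_atTop
  obtain ⟨N, hN⟩ := Metric.tendsto_atTop'.1 (isWeakStarNull_iff.1 hf' a) (ε / 2) (half_pos hε)
  have hinj : Function.Injective fun n => n + (N + 1) := add_left_injective _
  refine h.tendsto_apply hp (hf'.comp (tendsto_add_atTop_nat (N + 1))) (fun n => hpos _)
    (hs.comp_injective hinj) (half_pos hε) fun n => ?_
  have h1 := (hx (ψ (n + (N + 1)))).2
  have h2 := hN (n + (N + 1)) (by omega)
  simp only [Function.comp_apply, dist_zero_right, Real.norm_eq_abs] at h2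
  simp only [Function.comp_apply, map_sub]
  linarith [abs_sub_abs_le_abs_sub (f (θ (ψ (n + (N + 1)))) (x (ψ (n + (N + 1)))))
    (f (θ (ψ (n + (N + 1)))) a)]

end BanachLattice

theorem corollary3p8 {E : Type*} [NormedAddCommGroup E] [NormedSpace ℝ E] [CompleteSpace E]
    [Lattice E] [IsOrderedAddMonoid E] [IsOrderedModule ℝ E] [HasSolidNorm E]
    (hE : BanachLattice.IsSigmaDedekindComplete E) (p : ℝ) (hp : 2 ≤ p) :
    BanachLattice.HasPositiveDPStar p E ↔ BanachLattice.HasDisjointDPStar p E :=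
  ⟨fun h => h.hasDisjointDPStar hE (by linarith), fun h => h.hasPositiveDPStar (by linarith)⟩
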